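/- Let $n\ge 2$, $1\le d\le n-1$, $k\ge 3$ be integers, let $\mathbb T^n=\mathbb R^n/\mathbb Z^n$, and let $B\subset\mathbb R^n$ be open, bounded and convex. Write $|\cdot|$ for the supremum norm of vectors and tensors, $\theta=(\bar\theta,\tilde\theta)\in\mathbb T^d\times\mathbb T^{n-d}$, and let $\alpha=(0,\tilde\alpha)\in\mathbb R^d\times\mathbb R^{n-d}$ with $|\alpha|=1$, where $\tilde\alpha$ is non-resonant: $q\cdot\tilde\alpha\ne 0$ for every $q\in\mathbb Z^{n-d}\setminus\{0\}$. Let $C^k(\mathbb T^n\times\bar B)$ be the space of $k$-times differentiable functions on $\mathbb T^n\times B$ whose differentials up to order $k$ extend continuously to $\mathbb T^n\times\bar B$, with the norm $|g|_{C^k}=\max_{0\le l\le k}\sup|\nabla^l g|$. For such $g$ put $\bar g(\bar\theta,I)=\int_{\mathbb T^{n-d}}g(\bar\theta,\tilde\theta,I)\,d\tilde\theta$. Let $f\in C^k(\mathbb T^n\times\bar B)$ with $|f|_{C^k}\le 1$, and assume $(G1)$ $I_*\in B$ is such that the function $\bar\theta\mapsto\bar f(\bar\theta,I_*)$ on $\mathbb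 T^d$ is non-constant. Then there is $\bar\theta_*\in\mathbb T^d$ with $\partial_{\bar\theta}\bar f(\bar\theta_*,I_*)\neq 0$. Moreover, for every such $\bar\theta_*$ there exist constants $c_1,c_2>0$ and an open ball $B_*$ with $$B_*\subset B-c_1:=\{I\in B : B(I,c_1)\subset B\},$$ where $B(I,c_1)$ is the ball of radius $c_1$ around $I$, such that the following holds. Let $(f_\varepsilon)_{\varepsilon\ge 0}$ be any family in $C^k(\mathbb T^n\times\bar B)$ with $f_0=f$, $|f_\varepsilon|_{C^k}\le 1$ for all $\varepsilon\ge 0$, and $$\lim_{\varepsilon\to 0^+}|\partial_{\bar\theta}\bar f_\varepsilon(\bar\theta_*,I_*)-\partial_{\bar\theta}\bar f(\bar\theta_*,I_*)|=0.$$ Then there is $\varepsilon_0>0$ such that, for every $0<\varepsilon\le\varepsilon_0$ and every $I_0\in B_*$, with $\tau=c_2\varepsilon^{-1}$, the Hamiltonian system $$\dot\theta=\partial_I H,\qquad \dot I=-\partial_\theta H,\qquad H(\theta,I)=\alpha\cdot I+\varepsilon f_\varepsilon(\theta,I),$$ on $\mathbb T^n\times B$ has a solution $(\theta(t),I(t))$,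 $0\le t\le\tau$, with $I(0)=I_0$ and $$|I(\tau)-I_0|\ge c_1 .$$ In particular $c_1,c_2,B_*$ do not depend on $\varepsilon$ or on the family $(f_\varepsilon)_{\varepsilon>0}$, and $\varepsilon_0$ does not depend on $I_0$. -/

import Mathlib

open Set Filter Topology MeasureTheory
open scoped ENNReal

noncomputable section

/-- The projection of `ℝ^ι` onto the torus `𝕋^ι = ℝ^ι / ℤ^ι`. -/
def toTorus {ι : Type*} (x : ι → ℝ) : UnitAddTorus ι := fun i => (x i : UnitAddCircle)

/-- The lift to `ℝ^ι × ℝ^ι` of a function of angles and actions; it is `1`-periodic in each angle.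
Derivatives of functions on `𝕋^ι × ℝ^ι` are those of the lift. -/
def liftFun {ι : Type*} (f : UnitAddTorus ι × (ι → ℝ) → ℝ) : (ι → ℝ) × (ι → ℝ) → ℝ :=
  fun z => f (toTorus z.1, z.2)

/-- The canonical basis of `ℝ^ι × ℝ^ι`: first the angle directions, then the action directions. -/
def phaseBasis {ι : Type*} [DecidableEq ι] : ι ⊕ ι → (ι → ℝ) × (ι → ℝ) :=
  Sum.elim (fun i => (Pi.single i 1, 0)) (fun i => (0, Pi.single i 1))

/-- `f ∈ C^k(𝕋^ι × B̄)`: `f` is `k` times continuously differentiable on `𝕋^ι × B`, and its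
differentials up to order `k` extend continuously to `𝕋^ι × B̄`. -/
structure IsCkClosure {ι : Type*} [Fintype ι] (k : ℕ) (B : Set (ι → ℝ))
    (f : UnitAddTorus ι × (ι → ℝ) → ℝ) : Prop where
  contDiffOn : ContDiffOn ℝ k (liftFun f) (univ ×ˢ B)
  extends_closure : ∀ l ≤ k,
    ∃ G : (ι → ℝ) × (ι → ℝ) → ((ι → ℝ) × (ι → ℝ)) [×l]→L[ℝ] ℝ,
      ContinuousOn G (univ ×ˢ closure B) ∧ EqOn G (iteratedFDeriv ℝ l (liftFun f)) (univ ×ˢ B)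

/-- The norm `max_{l ≤ k} sup |∇^l f|` of `C^k(𝕋^ι × B̄)`, where `|∇^l f|` is the supremum norm of
the tensor `∇^l f`, that is the largest absolute value of a partial derivative of order `l`
(it is at most the operator norm of `∇^l f` for the supremum norm on vectors).
By continuity the supremum over `𝕋^ι × B̄` is the supremum over `𝕋^ι × B`. -/
def ckNorm {ι : Type*} [Fintype ι] [DecidableEq ι] (k : ℕ) (B : Set (ι → ℝ))
    (f : UnitAddTorus ι × (ι → ℝ) → ℝ) : ℝ≥0∞ :=
  ⨆ (l : ℕ) (_ : l ≤ k) (z : (ι → ℝ) × (ι → ℝ)) (_ : z ∈ univ ×ˢ B) (v : Fin l → ι ⊕ ι),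
    ‖iteratedFDeriv ℝ l (liftFun f) z (fun j => phaseBasis (v j))‖ₑ

/-- A vector is non-resonant if no non-zero integer vector is orthogonal to it. -/
def NonResonant {ι : Type*} [Fintype ι] (a : ι → ℝ) : Prop :=
  ∀ q : ι → ℤ, q ≠ 0 → ∑ i, (q i : ℝ) * a i ≠ 0

/-- The partial average `f̄(θ̄, I) = ∫ f(θ̄, θ̃, I) dθ̃` over the angles indexed by `κ`
(Haar probability measure of the torus). -/
def partialAverage {δ κ : Type*} [Fintype κ] (f : UnitAddTorus (δ ⊕ κ) × (δ ⊕ κ → ℝ) → ℝ)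
    (θbar : UnitAddTorus δ) (I : δ ⊕ κ → ℝ) : ℝ :=
  ∫ θtilde : UnitAddTorus κ, f (Sum.elim θbar θtilde, I)
    ∂(Measure.pi fun _ => AddCircle.haarAddCircle)

/-- The vector of partial derivatives `∂_θ̄ f̄(θ̄, I)`, at the point of the torus represented
by `θbar`. -/
def gradPartialAverage {δ κ : Type*} [Fintype δ] [DecidableEq δ] [Fintype κ]
    (f : UnitAddTorus (δ ⊕ κ) × (δ ⊕ κ → ℝ) → ℝ) (θbar : δ → ℝ) (I : δ ⊕ κ → ℝ) : δ → ℝ :=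
  fun j => fderiv ℝ (fun x : δ → ℝ => partialAverage f (toTorus x) I) θbar (Pi.single j 1)

/-- The Hamiltonian `H(θ, I) = α · I + ε g(θ, I)`. -/
def perturbedHamiltonian {ι : Type*} [Fintype ι] (α : ι → ℝ) (ε : ℝ)
    (g : UnitAddTorus ι × (ι → ℝ) → ℝ) : UnitAddTorus ι × (ι → ℝ) → ℝ :=
  fun z => ∑ i, α i * z.2 i + ε * g z

/-- The pair `(θ, I)` is a solution, on the time interval `J`, of the Hamiltonian system
`θ_i' = ∂H/∂I_i`, `I_i' = -∂H/∂θ_i` of a function `H` on `𝕋^ι × B`. The angles are given by their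
lift to `ℝ^ι`. -/
structure IsHamiltonianSolution {ι : Type*} [Fintype ι] [DecidableEq ι]
    (H : UnitAddTorus ι × (ι → ℝ) → ℝ) (B : Set (ι → ℝ)) (J : Set ℝ)
    (θ I : ℝ → ι → ℝ) : Prop where
  mem_domain : ∀ t ∈ J, I t ∈ B
  angle_eq : ∀ t ∈ J, ∀ i, HasDerivWithinAt (fun s => θ s i)
    (fderiv ℝ (liftFun H) (θ t, I t) (0, Pi.single i 1)) J t
  action_eq : ∀ t ∈ J, ∀ i, HasDerivWithinAt (fun s => I s i)
    (-fderiv ℝ (liftFun H) (θ t, I t) (Pi.single i 1, 0)) J t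

/-- The set `B - ζ` of the points of `B` whose ball of radius `ζ` is contained in `B`. -/
def shrink {ι : Type*} [Fintype ι] (B : Set (ι → ℝ)) (ζ : ℝ) : Set (ι → ℝ) :=
  {I | I ∈ B ∧ Metric.ball I ζ ⊆ B}

end

/-! The perturbation makes a slow action drift at speed of order ε, and resonance keeps the slow
angles in place long enough for the drift to accumulate. In the frame moving with the unperturbed
flow, the vector field has supremum norm at most ε. The solution starting at angle (θ*, 0) and
action I₀ therefore exists up to time c/ε and stays within c of the orbit (θ*, tα̃, I₀)
(`exists_isHamiltonianSolution`).

Choose j with v = ∂_j f̄(θ*, I*) ≠ 0. The second derivatives are bounded, so replacing the true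
orbit by (θ*, tα̃, I*) in the integral for I_j costs O(c²) when I₀ is within c of I*
(`abs_action_sub_add_integral_le`). What remains is a time average of ∂_j f_ε along a non-resonant
linear flow. It tends to the space average ∂_j f̄_ε(θ*, I*), which tends to v. The drift is thus -cv
up to O(c²) and errors that are small with ε, and c is fixed small in terms of |v|.

No Diophantine rate is needed: the threshold for ε must only be uniform in the perturbation. The
functions being averaged are bounded by 1 with a common Lipschitz constant, so Arzelà–Ascoli
supplies this uniformity (`eventually_flowDiscrepancy_le`). -/

open Set Filter Topology MeasureTheory
open scoped ENNReal

noncomputable section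

/-! ### Uniform equidistribution of non-resonant linear flows. -/

section
variable {ι : Type*}

@[fun_prop]
theorem continuous_toTorus : Continuous (toTorus : (ι → ℝ) → UnitAddTorus ι) :=
  continuous_pi fun i => (AddCircle.continuous_mk' 1).comp (continuous_apply i)

theorem toTorus_surjective : Function.Surjective (toTorus : (ι → ℝ) → UnitAddTorus ι) := by
  intro y
  choose x hx using fun i => QuotientAddGroup.mk_surjective (y i)
  exact ⟨x, funext hx⟩

/-- Two points of the torus have lifts at the same distance. -/
theorem exists_lift_dist_eq [Fintype ι] (x y : UnitAddTorus ι) :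
    ∃ u v : ι → ℝ, toTorus u = x ∧ toTorus v = y ∧ dist u v = dist x y := by
  obtain ⟨u, rfl⟩ := toTorus_surjective x
  obtain ⟨v, rfl⟩ := toTorus_surjective y
  -- Shift each coordinate of `u` by the integer that brings it nearest to `v`.
  refine ⟨fun i => u i - round (u i - v i), v, ?_, rfl, ?_⟩
  · funext i
    simp [toTorus]
  · have h : ∀ i, dist (u i - round (u i - v i)) (v i) = dist (toTorus u i) (toTorus v i) := by
      intro i
      rw [dist_eq_norm, dist_eq_norm, Real.norm_eq_abs]
      change _ = ‖((u i : ℝ) : UnitAddCircle) - ((v i : ℝ) : UnitAddCircle)‖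
      rw [← AddCircle.coe_sub, UnitAddCircle.norm_eq]
      congr 1
      ring
    simp only [dist_pi_def, nndist_dist, h]

theorem lipschitzWith_of_lift [Fintype ι] {E : Type*} [PseudoMetricSpace E] {K : NNReal}
    {g : UnitAddTorus ι → E} (hg : LipschitzWith K fun u => g (toTorus u)) : LipschitzWith K g := by
  refine LipschitzWith.of_dist_le_mul fun x y => ?_
  obtain ⟨u, v, rfl, rfl, h⟩ := exists_lift_dist_eq x y
  rw [← h]
  exact hg.dist_le_mul u v

/-- Haar probability measure on the torus. -/
abbrev torusHaar (ι : Type*) [Fintype ι] : Measure (UnitAddTorus ι) :=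
  Measure.pi fun _ => AddCircle.haarAddCircle

/-- Translation by 1/(2n) preserves Haar measure and changes the sign of the character. -/
theorem integral_fourier_of_ne_zero {n : ℤ} (hn : n ≠ 0) :
    ∫ x : UnitAddCircle, fourier n x ∂AddCircle.haarAddCircle = 0 :=
  integral_eq_zero_of_add_right_eq_neg (fourier_add_half_inv_index hn one_pos)

theorem integral_mFourier [Fintype ι] {q : ι → ℤ} (hq : q ≠ 0) :
    ∫ x, UnitAddTorus.mFourier q x ∂torusHaar ι = 0 := by
  obtain ⟨i, hi⟩ := Function.ne_iff.mp hq
  have h := integral_fintype_prod_eq_prod (μ := fun _ : ι => AddCircle.haarAddCircle (T := 1))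
    (fun i (y : UnitAddCircle) => (fourier (q i) y : ℂ))
  refine h.trans (Finset.prod_eq_zero (Finset.mem_univ i) (integral_fourier_of_ne_zero hi))

/-- Difference between the average of `g` along an orbit segment of the linear flow of frequency `a`
and the space average of `g`. -/
def flowDiscrepancy [Fintype ι] (a : ι → ℝ) (T : ℝ) (g : C(UnitAddTorus ι, ℂ)) : ℂ :=
  (T⁻¹ : ℝ) • (∫ t in (0 : ℝ)..T, g (toTorus (t • a))) - ∫ x, g x ∂torusHaar ι

theorem intervalIntegrable_flow (a : ι → ℝ) (g : C(UnitAddTorus ι, ℂ)) (s T : ℝ) :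
    IntervalIntegrable (fun t : ℝ => g (toTorus (t • a))) volume s T :=
  Continuous.intervalIntegrable (by fun_prop) _ _

variable [Fintype ι] (a : ι → ℝ)

theorem integrable_torusHaar (g : C(UnitAddTorus ι, ℂ)) : Integrable g (torusHaar ι) :=
  g.continuous.integrable_of_hasCompactSupport (HasCompactSupport.of_compactSpace _)

theorem flowDiscrepancy_add (T : ℝ) (g h : C(UnitAddTorus ι, ℂ)) :
    flowDiscrepancy a T (g + h) = flowDiscrepancy a T g + flowDiscrepancy a T h := by
  simp only [flowDiscrepancy, ContinuousMap.add_apply]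
  rw [intervalIntegral.integral_add (intervalIntegrable_flow a g _ _)
    (intervalIntegrable_flow a h _ _), integral_add (integrable_torusHaar g)
    (integrable_torusHaar h), smul_add]
  ring

theorem flowDiscrepancy_smul (T : ℝ) (c : ℂ) (g : C(UnitAddTorus ι, ℂ)) :
    flowDiscrepancy a T (c • g) = c * flowDiscrepancy a T g := by
  simp only [flowDiscrepancy, ContinuousMap.smul_apply]
  rw [intervalIntegral.integral_smul, integral_smul, smul_comm, ← smul_sub, smul_eq_mul]

/-- The bound does not depend on `T`, so convergence passes to uniform limits in `g`. -/
theorem norm_flowDiscrepancy_le {T : ℝ} (hT : 0 < T) (g : C(UnitAddTorus ι, ℂ)) :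
    ‖flowDiscrepancy a T g‖ ≤ 2 * ‖g‖ := by
  have h1 : ‖∫ t in (0 : ℝ)..T, g (toTorus (t • a))‖ ≤ ‖g‖ * |T - 0| :=
    intervalIntegral.norm_integral_le_of_norm_le_const fun t _ => g.norm_coe_le_norm _
  have h2 : ‖∫ x, g x ∂torusHaar ι‖ ≤ ‖g‖ * (torusHaar ι).real univ :=
    norm_integral_le_of_norm_le_const (.of_forall g.norm_coe_le_norm)
  rw [probReal_univ, mul_one] at h2
  rw [sub_zero, abs_of_pos hT] at h1
  have h3 : ‖(T⁻¹ : ℝ) • (∫ t in (0 : ℝ)..T, g (toTorus (t • a)))‖ ≤ ‖g‖ := by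
    rw [norm_smul, Real.norm_eq_abs, abs_of_pos (inv_pos.mpr hT), inv_mul_le_iff₀ hT, mul_comm]
    exact h1
  calc ‖flowDiscrepancy a T g‖ ≤ _ := norm_sub_le _ _
    _ ≤ ‖g‖ + ‖g‖ := add_le_add h3 h2
    _ = 2 * ‖g‖ := by ring

theorem mFourier_flow (q : ι → ℤ) (t : ℝ) :
    UnitAddTorus.mFourier q (toTorus (t • a))
      = Complex.exp ((2 * Real.pi * ((∑ i, (q i : ℝ) * a i : ℝ) : ℂ) * Complex.I) * t) := by
  simp only [UnitAddTorus.mFourier, ContinuousMap.coe_mk, toTorus, fourier_coe_apply]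
  rw [← Complex.exp_sum]
  congr 1
  push_cast
  simp only [Finset.mul_sum, Finset.sum_mul]
  refine Finset.sum_congr rfl fun i _ => ?_
  simp
  ring

variable {a}

/-- Along the flow a character is exp(ct) with c imaginary, and non-resonance gives c ≠ 0 when q ≠
0. Its primitive is then bounded, and the time average is O(1/T). -/
theorem tendsto_flowDiscrepancy_mFourier (ha : NonResonant a) (q : ι → ℤ) :
    Tendsto (fun T => flowDiscrepancy a T (UnitAddTorus.mFourier q)) atTop (𝓝 0) := by
  by_cases hq : q = 0
  · subst hq
    refine (tendsto_congr' ?_).mpr tendsto_const_nhds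
    filter_upwards [eventually_gt_atTop 0] with T hT
    simp [flowDiscrepancy, UnitAddTorus.mFourier_zero, hT.ne']
  · set c : ℂ := 2 * Real.pi * ((∑ i, (q i : ℝ) * a i : ℝ) : ℂ) * Complex.I with hc
    have hc0 : c ≠ 0 := by
      simp only [hc, ne_eq, mul_eq_zero, Complex.ofReal_eq_zero, not_or]
      exact ⟨⟨⟨two_ne_zero, Real.pi_ne_zero⟩, ha q hq⟩, Complex.I_ne_zero⟩
    have hre : ∀ T : ℝ, ‖Complex.exp (c * T)‖ = 1 := by
      intro T
      have : c * T = ((2 * Real.pi * (∑ i, (q i : ℝ) * a i) * T : ℝ) : ℂ) * Complex.I := by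
        rw [hc]; push_cast; ring
      rw [this, Complex.norm_exp_ofReal_mul_I]
    have hb : ∀ᶠ T : ℝ in atTop,
        ‖flowDiscrepancy a T (UnitAddTorus.mFourier q)‖ ≤ T⁻¹ * (2 / ‖c‖) := by
      filter_upwards [eventually_gt_atTop 0] with T hT
      simp only [flowDiscrepancy, integral_mFourier hq, sub_zero, mFourier_flow, ← hc]
      rw [integral_exp_mul_complex hc0, norm_smul, Real.norm_eq_abs, abs_of_pos (inv_pos.mpr hT),
        norm_div]
      gcongr
      refine (norm_sub_le _ _).trans ?_
      rw [hre, hre]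
      norm_num
    refine squeeze_zero_norm' hb ?_
    simpa using tendsto_inv_atTop_zero.mul_const (2 / ‖c‖)

/-- Equidistribution of the linear flow with non-resonant frequency. -/
theorem tendsto_flowDiscrepancy (ha : NonResonant a) (g : C(UnitAddTorus ι, ℂ)) :
    Tendsto (fun T => flowDiscrepancy a T g) atTop (𝓝 0) := by
  have hspan : ∀ h ∈ Submodule.span ℂ (range (UnitAddTorus.mFourier (d := ι))),
      Tendsto (fun T => flowDiscrepancy a T h) atTop (𝓝 0) := by
    intro h hh
    induction hh using Submodule.span_induction with
    | mem x hx => obtain ⟨q, rfl⟩ := hx; exact tendsto_flowDiscrepancy_mFourier ha q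
    | zero => simp [flowDiscrepancy]
    | add x y _ _ hx hy => simpa only [flowDiscrepancy_add, add_zero] using hx.add hy
    | smul c x _ hx => simpa only [flowDiscrepancy_smul, mul_zero] using hx.const_mul c
  rw [Metric.tendsto_nhds]
  intro ε hε
  have hg : g ∈ (Submodule.span ℂ (range (UnitAddTorus.mFourier (d := ι)))).topologicalClosure := by
    rw [UnitAddTorus.span_mFourier_closure_eq_top]; trivial
  obtain ⟨h, hh, hgh⟩ := Metric.mem_closure_iff.mp hg (ε / 4) (by positivity)
  filter_upwards [eventually_gt_atTop 0,
    Metric.tendsto_nhds.mp (hspan h hh) (ε / 2) (by positivity)] with T hT hT'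
  rw [dist_zero_right] at hT' ⊢
  have hd := norm_flowDiscrepancy_le a hT (g - h)
  rw [← dist_eq_norm g h] at hd
  calc ‖flowDiscrepancy a T g‖ = ‖flowDiscrepancy a T (g - h) + flowDiscrepancy a T h‖ := by
        rw [← flowDiscrepancy_add, sub_add_cancel]
    _ ≤ _ := norm_add_le _ _
    _ < ε := by linarith

/-- Equidistribution is uniform over an equi-Lipschitz bounded family. -/
theorem eventually_flowDiscrepancy_le (ha : NonResonant a) (K : NNReal) {η : ℝ} (hη : 0 < η) :
    ∀ᶠ T in atTop, ∀ g : C(UnitAddTorus ι, ℂ), (∀ x, ‖g x‖ ≤ 1) → LipschitzWith K g →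
      ‖flowDiscrepancy a T g‖ ≤ η := by
  let A : Set (BoundedContinuousFunction (UnitAddTorus ι) ℂ) :=
    {g | (∀ x, ‖g x‖ ≤ 1) ∧ LipschitzWith K g}
  have hA : IsCompact (closure A) := by
    refine BoundedContinuousFunction.arzela_ascoli (Metric.closedBall 0 1)
      (isCompact_closedBall 0 1) A (fun f x hf => by simpa using hf.1 x) ?_
    exact (LipschitzWith.uniformEquicontinuous (fun g : A => (g : UnitAddTorus ι → ℂ)) K
      fun g => g.2.2).equicontinuous
  have htb : TotallyBounded A := hA.totallyBounded.subset subset_closure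
  -- A finite η/4-net reduces uniformity to finitely many functions; the total error is 2 · η/4 +
  -- η/2.
  obtain ⟨N, hN, hAN⟩ := Metric.totallyBounded_iff.mp htb (η / 4) (by positivity)
  have hev : ∀ᶠ T in atTop, ∀ h ∈ N, ‖flowDiscrepancy a T h.toContinuousMap‖ < η / 2 := by
    rw [eventually_all_finite hN]
    intro h _
    simpa using Metric.tendsto_nhds.mp (tendsto_flowDiscrepancy ha h.toContinuousMap) (η / 2)
      (by positivity)
  filter_upwards [eventually_gt_atTop 0, hev] with T hT hev g hg1 hg2
  have hgA : BoundedContinuousFunction.mkOfCompact g ∈ A := ⟨hg1, hg2⟩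
  obtain ⟨h, hh, hgh⟩ := mem_iUnion₂.mp (hAN hgA)
  have hgh' : ‖g - h.toContinuousMap‖ ≤ η / 4 := by
    rw [ContinuousMap.norm_le _ (by positivity)]
    intro x
    have := BoundedContinuousFunction.dist_coe_le_dist (f := .mkOfCompact g) (g := h) x
    rw [dist_eq_norm] at this
    exact this.trans (Metric.mem_ball.mp hgh).le
  have hd := norm_flowDiscrepancy_le a hT (g - h.toContinuousMap)
  have := hev h hh
  calc ‖flowDiscrepancy a T g‖
      = ‖flowDiscrepancy a T (g - h.toContinuousMap) + flowDiscrepancy a T h.toContinuousMap‖ := by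
        rw [← flowDiscrepancy_add, sub_add_cancel]
    _ ≤ _ := norm_add_le _ _
    _ ≤ η := by linarith

/-- Uniform equidistribution for real functions. -/
theorem eventually_abs_integral_flow_sub_le (ha : NonResonant a) (K : NNReal) {η : ℝ}
    (hη : 0 < η) :
    ∀ᶠ T : ℝ in atTop, ∀ g : UnitAddTorus ι → ℝ, (∀ x, |g x| ≤ 1) → LipschitzWith K g →
      |(∫ t in (0 : ℝ)..T, g (toTorus (t • a))) - T * ∫ x, g x ∂torusHaar ι| ≤ T * η := by
  filter_upwards [eventually_gt_atTop 0, eventually_flowDiscrepancy_le ha K hη] with T hT h g h1 h2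
  have hg : LipschitzWith K fun x => (g x : ℂ) := by
    simpa [Function.comp_def] using Complex.isometry_ofReal.lipschitz.comp h2
  have := h ⟨fun x => (g x : ℂ), hg.continuous⟩ (by simpa using h1) hg
  simp only [flowDiscrepancy, ContinuousMap.coe_mk] at this
  rw [intervalIntegral.integral_ofReal, integral_complex_ofReal, Complex.real_smul, ← Complex.ofReal_mul,
    ← Complex.ofReal_sub, Complex.norm_real, Real.norm_eq_abs] at this
  have e : (∫ t in (0 : ℝ)..T, g (toTorus (t • a))) - T * ∫ x, g x ∂torusHaar ι
      = T * (T⁻¹ * (∫ t in (0 : ℝ)..T, g (toTorus (t • a))) - ∫ x, g x ∂torusHaar ι) := by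
    field_simp
  rw [e, abs_mul, abs_of_pos hT]
  gcongr

end

/-! ### Derivative bounds and the Hamiltonian vector field. -/

section
variable {ι : Type*}

/-- The lift is invariant under the translation by `y - x`, hence so is its differential, which
therefore descends to the torus. -/
theorem fderiv_liftFun_congr [Fintype ι] (f : UnitAddTorus ι × (ι → ℝ) → ℝ) {x y : ι → ℝ}
    (h : toTorus x = toTorus y) (I : ι → ℝ) :
    fderiv ℝ (liftFun f) (x, I) = fderiv ℝ (liftFun f) (y, I) := by
  have hper : liftFun f = fun z => liftFun f (z + (y - x, 0)) := by
    funext z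
    have : toTorus (z.1 + (y - x)) = toTorus z.1 := by
      funext i
      have hi : ((x i : ℝ) : UnitAddCircle) = (y i : ℝ) := congrFun h i
      simp [toTorus, hi]
    simp [liftFun, this]
  conv_lhs => rw [hper]
  rw [fderiv_comp_add_right]
  simp

theorem norm_phaseBasis_le [Fintype ι] [DecidableEq ι] (a : ι ⊕ ι) :
    ‖(phaseBasis a : (ι → ℝ) × (ι → ℝ))‖ ≤ 1 := by
  have h : ∀ i : ι, ‖(Pi.single i 1 : ι → ℝ)‖ ≤ 1 := fun i => by
    refine (pi_norm_le_iff_of_nonneg zero_le_one).mpr fun j => ?_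
    by_cases hj : j = i
    · subst hj; simp
    · simp [hj]
  rcases a with i | i <;> simpa [phaseBasis, Prod.norm_def] using h i

/-- A coordinate of a vector in the basis `phaseBasis`. -/
def phaseCoord (w : (ι → ℝ) × (ι → ℝ)) : ι ⊕ ι → ℝ := Sum.elim w.1 w.2

variable [Fintype ι]

theorem abs_phaseCoord_le (w : (ι → ℝ) × (ι → ℝ)) (a : ι ⊕ ι) : |phaseCoord w a| ≤ ‖w‖ := by
  rcases a with i | i
  · exact (norm_le_pi_norm w.1 i).trans (norm_fst_le w)
  · exact (norm_le_pi_norm w.2 i).trans (norm_snd_le w)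

variable [DecidableEq ι]

theorem sum_phaseCoord_smul (w : (ι → ℝ) × (ι → ℝ)) :
    ∑ a, phaseCoord w a • (phaseBasis a : (ι → ℝ) × (ι → ℝ)) = w := by
  ext i <;> simp [phaseCoord, phaseBasis, Prod.fst_sum, Prod.snd_sum, Finset.sum_apply,
    Pi.single_apply]

/-- `ckNorm` bounds partial derivatives only; passing to operator norms costs a dimensional factor
per order. -/
theorem norm_le_of_phaseBasis {F : Type*} [NormedAddCommGroup F] [NormedSpace ℝ F] {C : ℝ}
    (hC : 0 ≤ C) (A : (ι → ℝ) × (ι → ℝ) →L[ℝ] F) (h : ∀ a, ‖A (phaseBasis a)‖ ≤ C) :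
    ‖A‖ ≤ Fintype.card (ι ⊕ ι) * C := by
  refine A.opNorm_le_bound (by positivity) fun w => ?_
  calc ‖A w‖ = ‖∑ a, phaseCoord w a • A (phaseBasis a)‖ := by
        conv_lhs => rw [← sum_phaseCoord_smul w, map_sum]
        simp only [map_smul]
    _ ≤ ∑ a : ι ⊕ ι, ‖w‖ * C := norm_sum_le_of_le _ fun a _ => by
        rw [norm_smul]
        exact mul_le_mul (abs_phaseCoord_le w a) (h a) (norm_nonneg _) (norm_nonneg _)
    _ = Fintype.card (ι ⊕ ι) * C * ‖w‖ := by simp; ring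

variable {k : ℕ} {B : Set (ι → ℝ)} {f : UnitAddTorus ι × (ι → ℝ) → ℝ}

theorem norm_iteratedFDeriv_phaseBasis_le (hf1 : ckNorm k B f ≤ 1) {l : ℕ} (hl : l ≤ k)
    {z : (ι → ℝ) × (ι → ℝ)} (hz : z.2 ∈ B) (v : Fin l → ι ⊕ ι) :
    ‖iteratedFDeriv ℝ l (liftFun f) z (fun j => phaseBasis (v j))‖ ≤ 1 := by
  have hz' : z ∈ (univ : Set (ι → ℝ)) ×ˢ B := ⟨trivial, hz⟩
  have h : ‖iteratedFDeriv ℝ l (liftFun f) z (fun j => phaseBasis (v j))‖ₑ ≤ 1 :=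
    (le_iSup_of_le l <| le_iSup_of_le hl <| le_iSup_of_le z <| le_iSup_of_le hz' <|
      le_iSup (fun v : Fin l → ι ⊕ ι =>
        ‖iteratedFDeriv ℝ l (liftFun f) z (fun j => phaseBasis (v j))‖ₑ) v).trans hf1
  rw [← ofReal_norm] at h
  exact ENNReal.ofReal_le_one.mp h

theorem abs_fderiv_phaseBasis_le (hk : 1 ≤ k) (hf1 : ckNorm k B f ≤ 1)
    {z : (ι → ℝ) × (ι → ℝ)} (hz : z.2 ∈ B) (a : ι ⊕ ι) :
    |fderiv ℝ (liftFun f) z (phaseBasis a)| ≤ 1 := by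
  simpa using norm_iteratedFDeriv_phaseBasis_le hf1 hk hz fun _ => a

theorem norm_fderiv_liftFun_le (hk : 1 ≤ k) (hf1 : ckNorm k B f ≤ 1)
    {z : (ι → ℝ) × (ι → ℝ)} (hz : z.2 ∈ B) :
    ‖fderiv ℝ (liftFun f) z‖ ≤ Fintype.card (ι ⊕ ι) := by
  simpa using norm_le_of_phaseBasis zero_le_one _ (abs_fderiv_phaseBasis_le hk hf1 hz)

theorem norm_fderiv_fderiv_liftFun_le (hk : 2 ≤ k) (hf1 : ckNorm k B f ≤ 1)
    {z : (ι → ℝ) × (ι → ℝ)} (hz : z.2 ∈ B) :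
    ‖fderiv ℝ (fderiv ℝ (liftFun f)) z‖ ≤ Fintype.card (ι ⊕ ι) * Fintype.card (ι ⊕ ι) := by
  refine norm_le_of_phaseBasis (by positivity) _ fun a => ?_
  have h : ∀ b, ‖fderiv ℝ (fderiv ℝ (liftFun f)) z (phaseBasis a) (phaseBasis b)‖ ≤ 1 := by
    intro b
    have := norm_iteratedFDeriv_phaseBasis_le hf1 hk hz ![a, b]
    rw [iteratedFDeriv_two_apply] at this
    simpa using this
  simpa using norm_le_of_phaseBasis zero_le_one _ h

variable (ι) in
/-- A Lipschitz constant, for the supremum norm, of the differential of a function whose partial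
derivatives of order two are bounded by one. -/
def phaseLip : NNReal := Fintype.card (ι ⊕ ι) * Fintype.card (ι ⊕ ι)

omit [DecidableEq ι] in
theorem differentiableAt_liftFun (hB : IsOpen B) (hk : 1 ≤ k) (hf : IsCkClosure k B f)
    {z : (ι → ℝ) × (ι → ℝ)} (hz : z.2 ∈ B) : DifferentiableAt ℝ (liftFun f) z :=
  (hf.contDiffOn.contDiffAt ((isOpen_univ.prod hB).mem_nhds ⟨trivial, hz⟩)).differentiableAt
    (by exact_mod_cast (by omega : k ≠ 0))

theorem lipschitzOnWith_fderiv_liftFun (hB : IsOpen B) (hBc : Convex ℝ B) (hk : 2 ≤ k)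
    (hf : IsCkClosure k B f) (hf1 : ckNorm k B f ≤ 1) :
    LipschitzOnWith (phaseLip ι) (fderiv ℝ (liftFun f)) (univ ×ˢ B) := by
  refine (convex_univ.prod hBc).lipschitzOnWith_of_nnnorm_fderiv_le (𝕜 := ℝ) (fun z hz => ?_)
    fun z hz => ?_
  · have h := hf.contDiffOn.contDiffAt ((isOpen_univ.prod hB).mem_nhds hz)
    exact (h.fderiv_right (m := 1) (by exact_mod_cast hk)).differentiableAt (by norm_num)
  · rw [← NNReal.coe_le_coe]
    simpa [phaseLip] using norm_fderiv_fderiv_liftFun_le hk hf1 hz.2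

theorem lipschitzOnWith_liftFun (hB : IsOpen B) (hBc : Convex ℝ B) (hk : 1 ≤ k)
    (hf : IsCkClosure k B f) (hf1 : ckNorm k B f ≤ 1) :
    LipschitzOnWith (Fintype.card (ι ⊕ ι)) (liftFun f) (univ ×ˢ B) := by
  refine (convex_univ.prod hBc).lipschitzOnWith_of_nnnorm_fderiv_le (𝕜 := ℝ)
    (fun z hz => differentiableAt_liftFun hB hk hf hz.2) fun z hz => ?_
  rw [← NNReal.coe_le_coe]
  simpa using norm_fderiv_liftFun_le hk hf1 hz.2

/-- The Hamiltonian vector field `(∂L/∂I, -∂L/∂θ)` of a function `L`. -/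
def hamiltonianField (L : (ι → ℝ) × (ι → ℝ) → ℝ) (z : (ι → ℝ) × (ι → ℝ)) : (ι → ℝ) × (ι → ℝ) :=
  (fun i => fderiv ℝ L z (phaseBasis (.inr i)), fun i => -fderiv ℝ L z (phaseBasis (.inl i)))

/-- The components are first partial derivatives up to sign, and the supremum norm adds no
dimensional factor. This gives displacement at most `c` in time `c ε⁻¹`. -/
theorem norm_hamiltonianField_le (hk : 1 ≤ k) (hf1 : ckNorm k B f ≤ 1)
    {z : (ι → ℝ) × (ι → ℝ)} (hz : z.2 ∈ B) : ‖hamiltonianField (liftFun f) z‖ ≤ 1 := by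
  refine norm_prod_le_iff.mpr ⟨?_, ?_⟩ <;>
    refine (pi_norm_le_iff_of_nonneg zero_le_one).mpr fun i => ?_
  · exact abs_fderiv_phaseBasis_le hk hf1 hz (.inr i)
  · simpa [hamiltonianField] using abs_fderiv_phaseBasis_le hk hf1 hz (.inl i)

theorem lipschitzOnWith_hamiltonianField (hB : IsOpen B) (hBc : Convex ℝ B) (hk : 2 ≤ k)
    (hf : IsCkClosure k B f) (hf1 : ckNorm k B f ≤ 1) :
    LipschitzOnWith (phaseLip ι) (hamiltonianField (liftFun f)) (univ ×ˢ B) := by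
  refine LipschitzOnWith.of_dist_le_mul fun z hz w hw => ?_
  have hL := (lipschitzOnWith_fderiv_liftFun hB hBc hk hf hf1).dist_le_mul z hz w hw
  have h : ∀ a, dist (fderiv ℝ (liftFun f) z (phaseBasis a)) (fderiv ℝ (liftFun f) w (phaseBasis a))
      ≤ phaseLip ι * dist z w := by
    intro a
    refine le_trans ?_ hL
    rw [dist_eq_norm, dist_eq_norm, ← sub_apply]
    exact ContinuousLinearMap.unit_le_opNorm _ _ (norm_phaseBasis_le a)
  rw [Prod.dist_eq, max_le_iff]
  constructor <;> refine (dist_pi_le_iff (by positivity)).mpr fun i => ?_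
  · exact h (.inr i)
  · simpa [hamiltonianField] using h (.inl i)

end

/-! ### The gradient of the partial average as a space average. -/

section
variable {δ κ : Type*}

theorem toTorus_sumElim (x : δ → ℝ) (u : κ → ℝ) :
    toTorus (Sum.elim x u) = Sum.elim (toTorus x) (toTorus u) := by
  funext i
  rcases i with i | i <;> rfl

variable [Fintype δ] [Fintype κ]

theorem dist_sumElim_right (x : δ → ℝ) (u v : κ → ℝ) :
    dist (Sum.elim x u : δ ⊕ κ → ℝ) (Sum.elim x v) ≤ dist u v := by
  refine (dist_pi_le_iff dist_nonneg).mpr fun i => ?_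
  rcases i with i | i
  · simp
  · exact dist_le_pi_dist u v i

theorem dist_slow_angles_prod (x : δ → ℝ) (u v : κ → ℝ) (I : δ ⊕ κ → ℝ) :
    dist ((Sum.elim x u : δ ⊕ κ → ℝ), I) (Sum.elim x v, I) ≤ dist u v := by
  simpa [Prod.dist_eq] using dist_sumElim_right x u v

variable (δ κ) in
/-- The inclusion of the first group of angles in the phase space. -/
def slowAngles : (δ → ℝ) →L[ℝ] (δ ⊕ κ → ℝ) × (δ ⊕ κ → ℝ) :=
  (ContinuousLinearMap.inl ℝ _ _).comp
    (ContinuousLinearMap.pi (Sum.elim (fun i => ContinuousLinearMap.proj i) fun _ => 0))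

omit [Fintype δ] [Fintype κ] in
theorem slowAngles_apply (x : δ → ℝ) : slowAngles δ κ x = (Sum.elim x 0, 0) := by
  ext i
  · rcases i with i | i <;> simp [slowAngles]
  · simp [slowAngles]

theorem hasFDerivAt_slowAngles (x : δ → ℝ) (u : κ → ℝ) (I : δ ⊕ κ → ℝ) :
    HasFDerivAt (fun x : δ → ℝ => ((Sum.elim x u : δ ⊕ κ → ℝ), I)) (slowAngles δ κ) x := by
  have h := (slowAngles δ κ).hasFDerivAt (x := x) |>.add_const ((Sum.elim 0 u : δ ⊕ κ → ℝ), I)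
  refine h.congr_of_eventuallyEq (.of_forall fun y => ?_)
  simp only [slowAngles_apply, Prod.mk_add_mk, zero_add, Prod.mk.injEq, and_true]
  funext i
  rcases i with i | i <;> simp

/-- The differential of the lift of `f`, as a function of the second group of angles. -/
def fastDifferential (f : UnitAddTorus (δ ⊕ κ) × (δ ⊕ κ → ℝ) → ℝ) (x : δ → ℝ) (I : δ ⊕ κ → ℝ)
    (y : UnitAddTorus κ) : (δ ⊕ κ → ℝ) × (δ ⊕ κ → ℝ) →L[ℝ] ℝ :=
  fderiv ℝ (liftFun f) (Sum.elim x (Function.surjInv toTorus_surjective y), I)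

theorem fastDifferential_toTorus (f : UnitAddTorus (δ ⊕ κ) × (δ ⊕ κ → ℝ) → ℝ) (x : δ → ℝ)
    (I : δ ⊕ κ → ℝ) (u : κ → ℝ) :
    fastDifferential f x I (toTorus u) = fderiv ℝ (liftFun f) (Sum.elim x u, I) := by
  refine fderiv_liftFun_congr f ?_ I
  rw [toTorus_sumElim, toTorus_sumElim, Function.surjInv_eq toTorus_surjective]

variable [DecidableEq δ]

omit [Fintype δ] [Fintype κ] in
theorem slowAngles_single [DecidableEq κ] (j : δ) :
    slowAngles δ κ (Pi.single j 1) = phaseBasis (.inl (.inl j)) := by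
  rw [slowAngles_apply]
  ext i
  · rcases i with i | i <;> simp [phaseBasis, Pi.single_apply]
  · simp [phaseBasis]

variable [DecidableEq κ] {k : ℕ} {B : Set (δ ⊕ κ → ℝ)}
  {f : UnitAddTorus (δ ⊕ κ) × (δ ⊕ κ → ℝ) → ℝ}

theorem norm_fastDifferential_le (hk : 1 ≤ k) (hf1 : ckNorm k B f ≤ 1) {I : δ ⊕ κ → ℝ}
    (hI : I ∈ B) (x : δ → ℝ) (y : UnitAddTorus κ) :
    ‖fastDifferential f x I y‖ ≤ Fintype.card ((δ ⊕ κ) ⊕ (δ ⊕ κ)) :=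
  norm_fderiv_liftFun_le hk hf1 hI

theorem lipschitzWith_fastDifferential (hB : IsOpen B) (hBc : Convex ℝ B) (hk : 2 ≤ k)
    (hf : IsCkClosure k B f) (hf1 : ckNorm k B f ≤ 1) {I : δ ⊕ κ → ℝ} (hI : I ∈ B) (x : δ → ℝ) :
    LipschitzWith (phaseLip (δ ⊕ κ)) (fastDifferential f x I) := by
  refine lipschitzWith_of_lift (LipschitzWith.of_dist_le_mul fun u v => ?_)
  simp only [fastDifferential_toTorus]
  refine ((lipschitzOnWith_fderiv_liftFun hB hBc hk hf hf1).dist_le_mul _ ⟨trivial, hI⟩ _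
    ⟨trivial, hI⟩).trans ?_
  gcongr
  exact dist_slow_angles_prod x u v I

theorem integrable_fastDifferential (hB : IsOpen B) (hBc : Convex ℝ B) (hk : 2 ≤ k)
    (hf : IsCkClosure k B f) (hf1 : ckNorm k B f ≤ 1) {I : δ ⊕ κ → ℝ} (hI : I ∈ B) (x : δ → ℝ) :
    Integrable (fastDifferential f x I) (torusHaar κ) :=
  (lipschitzWith_fastDifferential hB hBc hk hf hf1 hI x).continuous.integrable_of_hasCompactSupport
    (HasCompactSupport.of_compactSpace _)

theorem continuous_fast (hB : IsOpen B) (hBc : Convex ℝ B) (hk : 1 ≤ k)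
    (hf : IsCkClosure k B f) (hf1 : ckNorm k B f ≤ 1) {I : δ ⊕ κ → ℝ} (hI : I ∈ B) (x : δ → ℝ) :
    Continuous fun y : UnitAddTorus κ => f (Sum.elim (toTorus x) y, I) := by
  refine (lipschitzWith_of_lift (K := Fintype.card ((δ ⊕ κ) ⊕ (δ ⊕ κ)))
    (LipschitzWith.of_dist_le_mul fun u v => ?_)).continuous
  simp only [← toTorus_sumElim]
  refine ((lipschitzOnWith_liftFun hB hBc hk hf hf1).dist_le_mul (Sum.elim x u, I) ⟨trivial, hI⟩
    (Sum.elim x v, I) ⟨trivial, hI⟩).trans ?_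
  gcongr
  exact dist_slow_angles_prod x u v I

/-- Differentiation of the partial average under the integral sign. -/
theorem hasFDerivAt_partialAverage (hB : IsOpen B) (hBc : Convex ℝ B) (hk : 2 ≤ k)
    (hf : IsCkClosure k B f) (hf1 : ckNorm k B f ≤ 1) {I : δ ⊕ κ → ℝ} (hI : I ∈ B) (x : δ → ℝ) :
    HasFDerivAt (fun x : δ → ℝ => partialAverage f (toTorus x) I)
      (∫ y, (fastDifferential f x I y).comp (slowAngles δ κ) ∂torusHaar κ) x := by
  have hk1 : 1 ≤ k := by omega
  have hc := fun x => continuous_fast hB hBc hk1 hf hf1 hI x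
  have hcomp : Continuous fun A : (δ ⊕ κ → ℝ) × (δ ⊕ κ → ℝ) →L[ℝ] ℝ => A.comp (slowAngles δ κ) :=
    (ContinuousLinearMap.precomp ℝ (slowAngles δ κ)).continuous
  refine hasFDerivAt_integral_of_dominated_of_fderiv_le (s := univ)
    (F' := fun x y => (fastDifferential f x I y).comp (slowAngles δ κ))
    (bound := fun _ => Fintype.card ((δ ⊕ κ) ⊕ (δ ⊕ κ)) * ‖slowAngles δ κ‖) univ_mem
    (.of_forall fun x => (hc x).aestronglyMeasurable)
    ((hc x).integrable_of_hasCompactSupport (HasCompactSupport.of_compactSpace _))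
    (hcomp.comp (lipschitzWith_fastDifferential hB hBc hk hf hf1 hI x).continuous
      |>.aestronglyMeasurable)
    (.of_forall fun y x _ => (ContinuousLinearMap.opNorm_comp_le _ _).trans ?_)
    (integrable_const _) (.of_forall fun y x _ => ?_)
  · gcongr
    exact norm_fastDifferential_le hk1 hf1 hI x y
  · obtain ⟨u, rfl⟩ := toTorus_surjective y
    rw [fastDifferential_toTorus]
    simp only [← toTorus_sumElim]
    exact (differentiableAt_liftFun hB hk1 hf (z := (Sum.elim x u, I)) hI).hasFDerivAt.comp x
      (hasFDerivAt_slowAngles x u I)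

/-- Identifies the limit of the time averages: equidistribution is applied to the partial derivative
of `f`, not to `f`. -/
theorem gradPartialAverage_eq_integral (hB : IsOpen B) (hBc : Convex ℝ B) (hk : 2 ≤ k)
    (hf : IsCkClosure k B f) (hf1 : ckNorm k B f ≤ 1) {I : δ ⊕ κ → ℝ} (hI : I ∈ B) (x : δ → ℝ)
    (j : δ) : gradPartialAverage f x I j
      = ∫ y, fastDifferential f x I y (phaseBasis (.inl (.inl j))) ∂torusHaar κ := by
  have hint : Integrable (fun y => (fastDifferential f x I y).comp (slowAngles δ κ))
      (torusHaar κ) :=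
    (ContinuousLinearMap.precomp ℝ (slowAngles δ κ)).integrable_comp
      (integrable_fastDifferential hB hBc hk hf hf1 hI x)
  rw [gradPartialAverage, (hasFDerivAt_partialAverage hB hBc hk hf hf1 hI x).fderiv,
    ContinuousLinearMap.integral_apply hint]
  simp [slowAngles_single]

theorem exists_gradPartialAverage_ne_zero (hB : IsOpen B) (hBc : Convex ℝ B) (hk : 2 ≤ k)
    (hf : IsCkClosure k B f) (hf1 : ckNorm k B f ≤ 1) {I : δ ⊕ κ → ℝ} (hI : I ∈ B)
    (hG : ¬ ∃ c : ℝ, ∀ x : UnitAddTorus δ, partialAverage f x I = c) :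
    ∃ x : δ → ℝ, gradPartialAverage f x I ≠ 0 := by
  by_contra! h
  refine hG ⟨partialAverage f (toTorus 0) I, fun y => ?_⟩
  obtain ⟨x, rfl⟩ := toTorus_surjective y
  refine is_const_of_fderiv_eq_zero (𝕜 := ℝ) (f := fun x => partialAverage f (toTorus x) I)
    (fun x => (hasFDerivAt_partialAverage hB hBc hk hf hf1 hI x).differentiableAt)
    (fun x => ?_) x 0
  refine ContinuousLinearMap.coe_injective (LinearMap.pi_ext' fun j => LinearMap.ext_ring ?_)
  simpa [gradPartialAverage] using congrFun (h x) j

end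

/-! ### Existence of solutions up to times of order ε⁻¹. -/

/-- The Picard–Lindelöf theorem, with the information that the solution stays in the ball on which
the vector field is controlled. -/
theorem IsPicardLindelof.exists_mem_closedBall_hasDerivWithinAt {E : Type*} [NormedAddCommGroup E]
    [NormedSpace ℝ E] [CompleteSpace E] {X : ℝ → E → E} {tmin tmax : ℝ} {t₀ : Icc tmin tmax}
    {x₀ : E} {a L K : NNReal} (hX : IsPicardLindelof X t₀ x₀ a 0 L K) :
    ∃ γ : ℝ → E, γ t₀ = x₀ ∧ (∀ t, γ t ∈ Metric.closedBall x₀ a) ∧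
      ∀ t ∈ Icc tmin tmax, HasDerivWithinAt γ (X t (γ t)) (Icc tmin tmax) t := by
  obtain ⟨γ, hγ⟩ := ODE.FunSpace.exists_isFixedPt_next hX (Metric.mem_closedBall_self le_rfl)
  -- `compProj` clamps time to the interval, so the confinement holds for every real `t`.
  have hmem : ∀ t, γ.compProj t ∈ Metric.closedBall x₀ a := fun t =>
    γ.compProj_mem_closedBall hX.mul_max_le
  have hpic : ∀ t ∈ Icc tmin tmax, γ.compProj t = ODE.picard X t₀ x₀ γ.compProj t := by
    intro t ht
    rw [ODE.FunSpace.compProj_of_mem ht]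
    conv_lhs => rw [← hγ]
    rfl
  refine ⟨γ.compProj, ?_, hmem, fun t ht => ?_⟩
  · rw [hpic t₀ t₀.2]
    simp [ODE.picard]
  · exact (ODE.hasDerivWithinAt_picard_Icc t₀.2 hX.continuousOn_uncurry
      γ.continuous_compProj.continuousOn (fun t _ => hmem t) x₀ ht).congr hpic (hpic t ht)

section
variable {ι : Type*} [Fintype ι]

theorem fderiv_liftFun_perturbedHamiltonian (α : ι → ℝ) (ε : ℝ)
    {f : UnitAddTorus ι × (ι → ℝ) → ℝ} {z : (ι → ℝ) × (ι → ℝ)}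
    (hf : DifferentiableAt ℝ (liftFun f) z) (w : (ι → ℝ) × (ι → ℝ)) :
    fderiv ℝ (liftFun (perturbedHamiltonian α ε f)) z w
      = ∑ i, α i * w.2 i + ε * fderiv ℝ (liftFun f) z w := by
  let A : (ι → ℝ) × (ι → ℝ) →L[ℝ] ℝ :=
    (∑ i, α i • ContinuousLinearMap.proj i).comp (ContinuousLinearMap.snd ℝ _ _)
  have hA : ∀ w, A w = ∑ i, α i * w.2 i := fun w => by simp [A]
  have h : HasFDerivAt (liftFun (perturbedHamiltonian α ε f)) (A + ε • fderiv ℝ (liftFun f) z) z := by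
    refine (A.hasFDerivAt.add (hf.hasFDerivAt.const_mul ε)).congr_of_eventuallyEq
      (.of_forall fun y => ?_)
    simp only [Pi.add_apply, hA]
    rfl
  rw [h.fderiv]
  simp [hA]

variable [DecidableEq ι] {k : ℕ} {B : Set (ι → ℝ)} {f : UnitAddTorus ι × (ι → ℝ) → ℝ}

/-- In the frame that moves with the unperturbed flow, the perturbed system has a solution on a time
interval of length `c ε⁻¹`, which moves by at most `c`. -/
theorem exists_moving_frame_solution (hB : IsOpen B) (hBc : Convex ℝ B) (hk : 2 ≤ k)
    (hf : IsCkClosure k B f) (hf1 : ckNorm k B f ≤ 1) (α : ι → ℝ) {ε c : ℝ} (hε : 0 < ε)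
    (hc : 0 ≤ c) (x₀ I₀ : ι → ℝ) (hI₀ : Metric.closedBall I₀ c ⊆ B) :
    ∃ γ : ℝ → (ι → ℝ) × (ι → ℝ), γ 0 = (x₀, I₀) ∧ (∀ t, γ t ∈ Metric.closedBall (x₀, I₀) c) ∧
      ∀ t ∈ Icc 0 (c * ε⁻¹), HasDerivWithinAt γ
        (ε • hamiltonianField (liftFun f) ((γ t).1 + t • α, (γ t).2)) (Icc 0 (c * ε⁻¹)) t := by
  have hτ : 0 ≤ c * ε⁻¹ := by positivity
  let X : ℝ → (ι → ℝ) × (ι → ℝ) → (ι → ℝ) × (ι → ℝ) := fun t z =>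
    ε • hamiltonianField (liftFun f) (z.1 + t • α, z.2)
  have hdist : ∀ z ∈ Metric.closedBall (x₀, I₀) c, dist z.1 x₀ ≤ c ∧ dist z.2 I₀ ≤ c :=
    fun z hz => by rwa [Metric.mem_closedBall, Prod.dist_eq, max_le_iff] at hz
  have hball : ∀ z ∈ Metric.closedBall (x₀, I₀) c, z.2 ∈ B := fun z hz => hI₀ (hdist z hz).2
  obtain ⟨ε', hε'⟩ : ∃ e : NNReal, (e : ℝ) = ε := ⟨⟨ε, hε.le⟩, rfl⟩
  obtain ⟨c', hc'⟩ : ∃ e : NNReal, (e : ℝ) = c := ⟨⟨c, hc⟩, rfl⟩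
  have hLip := lipschitzOnWith_hamiltonianField hB hBc hk hf hf1
  have hX : IsPicardLindelof X (⟨0, left_mem_Icc.mpr hτ⟩ : Icc 0 (c * ε⁻¹)) (x₀, I₀) c' 0
      ε' (ε' * phaseLip ι) := by
    rw [← hc'] at hball
    refine ⟨fun t _ => LipschitzOnWith.of_dist_le_mul fun z hz w hw => ?_, fun z hz => ?_,
      fun t _ z hz => ?_, ?_⟩
    · have h := hLip.dist_le_mul (z.1 + t • α, z.2) ⟨trivial, hball z hz⟩ (w.1 + t • α, w.2)
        ⟨trivial, hball w hw⟩
      -- The change of frame is an isometry, so the Lipschitz constant does not depend on `t`.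
      have e : dist (z.1 + t • α, z.2) (w.1 + t • α, w.2) = dist z w := by simp [Prod.dist_eq]
      rw [e] at h
      simp only [X, dist_smul₀, Real.norm_eq_abs, abs_of_pos hε, NNReal.coe_mul, hε', mul_assoc]
      gcongr
    · refine ContinuousOn.const_smul (hLip.continuousOn.comp (t := univ ×ˢ B) ?_ ?_) ε
      · exact Continuous.continuousOn (by fun_prop)
      · exact fun t _ => ⟨trivial, hball z hz⟩
    · have := norm_hamiltonianField_le (by omega) hf1 (z := (z.1 + t • α, z.2)) (hball z hz)
      simp only [X, norm_smul, Real.norm_eq_abs, abs_of_pos hε, hε']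
      nlinarith
    · rw [hε', hc', sub_zero, sub_self, max_eq_left (by simpa using hτ), NNReal.coe_zero, sub_zero]
      field_simp
      exact le_rfl
  simpa only [hc'] using hX.exists_mem_closedBall_hasDerivWithinAt

/-- The solution of the perturbed system exists on a time interval of length `c ε⁻¹`, on which it
stays at distance at most `c` from the solution of the unperturbed system. -/
theorem exists_isHamiltonianSolution (hB : IsOpen B) (hBc : Convex ℝ B) (hk : 2 ≤ k)
    (hf : IsCkClosure k B f) (hf1 : ckNorm k B f ≤ 1) (α : ι → ℝ) {ε c : ℝ} (hε : 0 < ε)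
    (hc : 0 ≤ c) (x₀ I₀ : ι → ℝ) (hI₀ : Metric.closedBall I₀ c ⊆ B) :
    ∃ θ I : ℝ → ι → ℝ,
      IsHamiltonianSolution (perturbedHamiltonian α ε f) B (Icc 0 (c * ε⁻¹)) θ I ∧ I 0 = I₀ ∧
      ∀ t ∈ Icc 0 (c * ε⁻¹), dist (θ t) (x₀ + t • α) ≤ c ∧ dist (I t) I₀ ≤ c := by
  have hk1 : 1 ≤ k := by omega
  obtain ⟨γ, h0, hmem, hder⟩ := exists_moving_frame_solution hB hBc hk hf hf1 α hε hc x₀ I₀ hI₀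
  have hdist : ∀ t, dist (γ t).1 x₀ ≤ c ∧ dist (γ t).2 I₀ ≤ c := fun t => by
    simpa [Prod.dist_eq] using hmem t
  have hball : ∀ t, (γ t).2 ∈ B := fun t => hI₀ (hdist t).2
  have hdiff : ∀ t, DifferentiableAt ℝ (liftFun f) ((γ t).1 + t • α, (γ t).2) :=
    fun t => differentiableAt_liftFun hB hk1 hf (hball t)
  refine ⟨fun t => (γ t).1 + t • α, fun t => (γ t).2, ⟨fun t _ =>
    hball t, fun t ht i => ?_, fun t ht i => ?_⟩, by simp [h0], fun t _ => ⟨?_, ?_⟩⟩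
  · rw [fderiv_liftFun_perturbedHamiltonian α ε (hdiff t)]
    have h1 := hasDerivWithinAt_pi.mp ((hasFDerivAt_fst.comp_hasDerivWithinAt t (hder t ht))) i
    have h2 := h1.add ((hasDerivWithinAt_id t (Icc 0 (c * ε⁻¹))).mul_const (α i))
    refine h2.congr_deriv ?_
    simp [hamiltonianField, phaseBasis, Pi.single_apply, add_comm]
  · rw [fderiv_liftFun_perturbedHamiltonian α ε (hdiff t)]
    refine (hasDerivWithinAt_pi.mp
      ((hasFDerivAt_snd.comp_hasDerivWithinAt t (hder t ht))) i).congr_deriv ?_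
    simp [hamiltonianField, phaseBasis]
  · rw [dist_add_right]
    exact (hdist t).1
  · exact (hdist t).2

end

/-! ### Comparison of the drift with its average. -/

section
variable {δ κ : Type*} [Fintype δ] [Fintype κ] [DecidableEq δ] [DecidableEq κ] {k : ℕ}
  {B : Set (δ ⊕ κ → ℝ)} {f : UnitAddTorus (δ ⊕ κ) × (δ ⊕ κ → ℝ) → ℝ}

/-- Along an orbit that shadows the unperturbed one, the drift of a slow action is given by the
integral of the perturbation along the unperturbed orbit. -/
theorem abs_action_sub_add_integral_le (hB : IsOpen B) (hBc : Convex ℝ B) (hk : 2 ≤ k)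
    (hf : IsCkClosure k B f) (hf1 : ckNorm k B f ≤ 1) {α : δ ⊕ κ → ℝ} {ε τ D : ℝ} (hε : 0 < ε)
    (hτ : 0 ≤ τ) {θ I : ℝ → δ ⊕ κ → ℝ}
    (hsol : IsHamiltonianSolution (perturbedHamiltonian α ε f) B (Icc 0 τ) θ I)
    {x : δ → ℝ} {a : κ → ℝ} {J : δ ⊕ κ → ℝ} (hJ : J ∈ B)
    (hD : ∀ t ∈ Icc 0 τ, dist (θ t, I t) ((Sum.elim x (t • a) : δ ⊕ κ → ℝ), J) ≤ D) (j : δ) :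
    |I τ (.inl j) - I 0 (.inl j) + ε * ∫ t in (0 : ℝ)..τ,
      fastDifferential f x J (toTorus (t • a)) (phaseBasis (.inl (.inl j)))|
      ≤ ε * (phaseLip (δ ⊕ κ) * D) * τ := by
  set e : (δ ⊕ κ → ℝ) × (δ ⊕ κ → ℝ) := phaseBasis (.inl (.inl j)) with he
  set g : ℝ → ℝ := fun t => fastDifferential f x J (toTorus (t • a)) e with hg
  have hgc : Continuous g := by
    have h1 : Continuous fun t : ℝ => fastDifferential f x J (toTorus (t • a)) :=
      (lipschitzWith_fastDifferential hB hBc hk hf hf1 hJ x).continuous.comp (by fun_prop)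
    exact h1.clm_apply continuous_const
  -- The predicted drift is added to the action; the mean value inequality is then applied to a
  -- function with small derivative.
  have hder : ∀ t ∈ Icc 0 τ, HasDerivWithinAt
      (fun t => I t (.inl j) + ε * ∫ s in (0 : ℝ)..t, g s)
      (-(ε * fderiv ℝ (liftFun f) (θ t, I t) e) + ε * g t) (Icc 0 τ) t := by
    intro t ht
    have h1 := hsol.action_eq t ht (.inl j)
    rw [fderiv_liftFun_perturbedHamiltonian α ε
      (differentiableAt_liftFun hB (by omega) hf (hsol.mem_domain t ht))] at h1
    have h2 := ((hgc.integral_hasStrictDerivAt 0 t).hasDerivAt.const_mul ε).hasDerivWithinAt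
      (s := Icc 0 τ)
    refine (h1.add h2).congr_deriv ?_
    simp [he, phaseBasis]
  have hbound : ∀ t ∈ Ico 0 τ, ‖-(ε * fderiv ℝ (liftFun f) (θ t, I t) e) + ε * g t‖
      ≤ ε * (phaseLip (δ ⊕ κ) * D) := by
    intro t ht
    have ht' := Ico_subset_Icc_self ht
    have hL := (lipschitzOnWith_fderiv_liftFun hB hBc hk hf hf1).dist_le_mul (θ t, I t)
      ⟨trivial, hsol.mem_domain t ht'⟩ (Sum.elim x (t • a), J) ⟨trivial, hJ⟩
    have hu := ContinuousLinearMap.unit_le_opNorm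
      (fderiv ℝ (liftFun f) (θ t, I t) - fderiv ℝ (liftFun f) (Sum.elim x (t • a), J)) e
      (norm_phaseBasis_le _)
    rw [← dist_eq_norm] at hu
    have heq : -(ε * fderiv ℝ (liftFun f) (θ t, I t) e) + ε * g t
        = -(ε * (fderiv ℝ (liftFun f) (θ t, I t)
          - fderiv ℝ (liftFun f) (Sum.elim x (t • a), J)) e) := by
      rw [hg, sub_apply]
      simp only [fastDifferential_toTorus]
      ring
    rw [heq, norm_neg, norm_mul, Real.norm_eq_abs, abs_of_pos hε]
    gcongr
    exact hu.trans (hL.trans (by gcongr; exact hD t ht'))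
  have h := norm_image_sub_le_of_norm_deriv_le_segment' hder hbound τ (right_mem_Icc.mpr hτ)
  simp only [intervalIntegral.integral_same, mul_zero, add_zero, sub_zero, Real.norm_eq_abs] at h
  convert! h using 2
  ring

/-- Comparison of the drift of a slow action with the averaged one, uniformly over perturbations of
norm at most one, for small `ε`. -/
theorem eventually_exists_solution_drift (hB : IsOpen B) (hBc : Convex ℝ B) (hk : 2 ≤ k)
    {a : κ → ℝ} (ha : NonResonant a) {J : δ ⊕ κ → ℝ} (hJ : J ∈ B) {c r η : ℝ} (hc : 0 < c)
    (hη : 0 < η) (hball : Metric.ball J (2 * c + r) ⊆ B) (x : δ → ℝ) (j : δ) :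
    ∀ᶠ ε in 𝓝[>] (0 : ℝ), ∀ f : UnitAddTorus (δ ⊕ κ) × (δ ⊕ κ → ℝ) → ℝ,
      IsCkClosure k B f → ckNorm k B f ≤ 1 → ∀ I₀ ∈ Metric.ball J r,
      ∃ θ I : ℝ → δ ⊕ κ → ℝ,
        IsHamiltonianSolution (perturbedHamiltonian (Sum.elim (fun _ => 0) a) ε f) B
          (Icc 0 (c * ε⁻¹)) θ I ∧ I 0 = I₀ ∧
        |I (c * ε⁻¹) (.inl j) - I₀ (.inl j) + c * gradPartialAverage f x J j|
          ≤ c * (phaseLip (δ ⊕ κ) * (c + r) + η) := by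
  have hlim : Tendsto (fun ε : ℝ => c * ε⁻¹) (𝓝[>] 0) atTop :=
    tendsto_inv_nhdsGT_zero.const_mul_atTop hc
  filter_upwards [self_mem_nhdsWithin,
    hlim.eventually (eventually_abs_integral_flow_sub_le ha (phaseLip (δ ⊕ κ)) hη)]
    with ε (hε : 0 < ε) herg f hf hf1 I₀ hI₀
  have hτ : 0 ≤ c * ε⁻¹ := by positivity
  have hετ : ε * (c * ε⁻¹) = c := by field_simp
  obtain ⟨θ, I, hsol, hI0, hdist⟩ := exists_isHamiltonianSolution hB hBc hk hf hf1
    (Sum.elim (fun _ => 0) a) hε hc.le (Sum.elim x 0) I₀ fun y hy => hball <| by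
      rw [Metric.mem_ball, Metric.mem_closedBall] at *
      linarith [dist_triangle y I₀ J]
  refine ⟨θ, I, hsol, hI0, ?_⟩
  rw [Metric.mem_ball] at hI₀
  have hr : 0 < r := dist_nonneg.trans_lt hI₀
  have h1 := abs_action_sub_add_integral_le hB hBc hk hf hf1 (D := c + r) hε hτ hsol (x := x)
    (a := a) hJ (fun t ht => by
      have hline : (Sum.elim x 0 : δ ⊕ κ → ℝ) + t • Sum.elim (fun _ => 0) a
          = Sum.elim x (t • a) := by
        funext i
        rcases i with i | i <;> simp
      obtain ⟨hθ, hI⟩ := hdist t ht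
      rw [hline] at hθ
      rw [Prod.dist_eq, max_le_iff]
      exact ⟨by linarith, by linarith [dist_triangle (I t) I₀ J]⟩) j
  have h2 := herg (fun y => fastDifferential f x J y (phaseBasis (.inl (.inl j))))
    (fun y => abs_fderiv_phaseBasis_le (by omega) hf1 hJ _)
    (LipschitzWith.of_dist_le_mul fun y z => by
      refine le_trans ?_
        ((lipschitzWith_fastDifferential hB hBc hk hf hf1 hJ x).dist_le_mul y z)
      rw [dist_eq_norm, dist_eq_norm, ← sub_apply]
      exact ContinuousLinearMap.unit_le_opNorm _ _ (norm_phaseBasis_le _))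
  rw [← gradPartialAverage_eq_integral hB hBc hk hf hf1 hJ] at h2
  rw [hI0] at h1
  set S := ∫ t in (0 : ℝ)..c * ε⁻¹,
    fastDifferential f x J (toTorus (t • a)) (phaseBasis (.inl (.inl j)))
  have h3 : |ε * S - c * gradPartialAverage f x J j| ≤ c * η := by
    have e : ε * S - c * gradPartialAverage f x J j
        = ε * (S - c * ε⁻¹ * gradPartialAverage f x J j) := by
      rw [mul_sub, ← mul_assoc, hετ]
    rw [e, abs_mul, abs_of_pos hε]
    calc _ ≤ ε * (c * ε⁻¹ * η) := by gcongr
      _ = c * η := by rw [← mul_assoc, hετ]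
  have h4 : ε * (phaseLip (δ ⊕ κ) * (c + r)) * (c * ε⁻¹) = c * (phaseLip (δ ⊕ κ) * (c + r)) := by
    linear_combination (phaseLip (δ ⊕ κ) * (c + r)) * hετ
  rw [h4] at h1
  rw [abs_le] at *
  constructor <;> linarith

end

end

/-! ### Choice of the constants and lower bound for the drift. -/

theorem theorem1 {d m : ℕ} (hd : 1 ≤ d) (hm : 1 ≤ m) (k : ℕ) (hk : 3 ≤ k)
    (B : Set (Fin d ⊕ Fin m → ℝ)) (hBo : IsOpen B) (hBb : Bornology.IsBounded B)
    (hBc : Convex ℝ B)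
    (αtilde : Fin m → ℝ) (hα : NonResonant αtilde)
    (α : Fin d ⊕ Fin m → ℝ) (hα0 : α = Sum.elim (fun _ => 0) αtilde) (hα1 : ‖α‖ = 1)
    (f : UnitAddTorus (Fin d ⊕ Fin m) × (Fin d ⊕ Fin m → ℝ) → ℝ)
    (hf : IsCkClosure k B f) (hf1 : ckNorm k B f ≤ 1)
    (Istar : Fin d ⊕ Fin m → ℝ) (hI : Istar ∈ B)
    (hG1 : ¬ ∃ c : ℝ, ∀ θbar : UnitAddTorus (Fin d), partialAverage f θbar Istar = c) :
    (∃ θstar : Fin d → ℝ, gradPartialAverage f θstar Istar ≠ 0) ∧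
    ∀ θstar : Fin d → ℝ, gradPartialAverage f θstar Istar ≠ 0 →
      ∃ c₁ > 0, ∃ c₂ > 0, ∃ (p : Fin d ⊕ Fin m → ℝ) (r : ℝ), 0 < r ∧
        Metric.ball p r ⊆ shrink B c₁ ∧
        ∀ F : ℝ → UnitAddTorus (Fin d ⊕ Fin m) × (Fin d ⊕ Fin m → ℝ) → ℝ,
          F 0 = f →
          (∀ ε ≥ 0, IsCkClosure k B (F ε) ∧ ckNorm k B (F ε) ≤ 1) →
          Tendsto (fun ε => ‖gradPartialAverage (F ε) θstar Istar
            - gradPartialAverage f θstar Istar‖) (𝓝[>] 0) (𝓝 0) →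
          ∃ ε₀ > 0, ∀ ε : ℝ, 0 < ε → ε ≤ ε₀ → ∀ I₀ ∈ Metric.ball p r,
            ∃ θ I : ℝ → Fin d ⊕ Fin m → ℝ,
              IsHamiltonianSolution (perturbedHamiltonian α ε (F ε)) B (Icc 0 (c₂ * ε⁻¹)) θ I ∧
              I 0 = I₀ ∧ c₁ ≤ ‖I (c₂ * ε⁻¹) - I₀‖ := by
  have hk2 : 2 ≤ k := by omega
  refine ⟨exists_gradPartialAverage_ne_zero hBo hBc hk2 hf hf1 hI hG1, fun θstar hgrad => ?_⟩
  obtain ⟨j, hj⟩ := Function.ne_iff.mp hgrad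
  set v := gradPartialAverage f θstar Istar j with hv
  have hv0 : 0 < |v| := abs_pos.mpr hj
  obtain ⟨ρ, hρ, hρB⟩ := Metric.isOpen_iff.mp hBo Istar hI
  set K : ℝ := ((phaseLip (Fin d ⊕ Fin m) : NNReal) : ℝ)
  have hK : 0 ≤ K := NNReal.coe_nonneg _
  -- The first condition leaves room for the radius 2c + r with r = c; the second makes the
  -- shadowing error, relative to c, at most |v|/8.
  obtain ⟨c, hc, hcρ, hcK⟩ : ∃ c > 0, 3 * c ≤ ρ ∧ K * (c + c) ≤ |v| / 8 := by
    refine ⟨min (ρ / 3) (|v| / (16 * (K + 1))), by positivity, ?_, ?_⟩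
    · linarith [min_le_left (ρ / 3) (|v| / (16 * (K + 1)))]
    · have h := min_le_right (ρ / 3) (|v| / (16 * (K + 1)))
      rw [le_div_iff₀ (by positivity)] at h
      have : 0 < min (ρ / 3) (|v| / (16 * (K + 1))) := by positivity
      nlinarith
  have hmin : 0 < min |v| 1 := lt_min hv0 one_pos
  have hmin1 : min |v| 1 ≤ 1 := min_le_right _ _
  have hmin2 : min |v| 1 ≤ |v| := min_le_left _ _
  -- The minimum with 1 gives c₁ ≤ c/2, so that c₁-balls around points of B(I*, c) stay in B(I*, ρ).
  refine ⟨c * min |v| 1 / 2, by positivity, c, hc, Istar, c, hc, fun I hIc => ?_,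
    fun F _ hF hlim => ?_⟩
  · rw [Metric.mem_ball] at hIc
    refine ⟨hρB (by rw [Metric.mem_ball]; linarith), fun y hy => hρB ?_⟩
    rw [Metric.mem_ball] at hy ⊢
    nlinarith [dist_triangle y I Istar]
  · have hdrift := eventually_exists_solution_drift (k := k) (r := c) (η := |v| / 8) hBo hBc hk2 hα hI hc
      (by positivity) ((Metric.ball_subset_ball (by linarith)).trans hρB) θstar j
    have hgrad' := hlim.eventually_lt_const (show (0 : ℝ) < |v| / 8 by positivity)
    obtain ⟨ε₀, hε₀, hsub⟩ := mem_nhdsGT_iff_exists_Ioc_subset.mp (hdrift.and hgrad')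
    refine ⟨ε₀, hε₀, fun ε hε hεε I₀ hI₀ => ?_⟩
    obtain ⟨h1, h2⟩ := hsub ⟨hε, hεε⟩
    obtain ⟨θ, I, hsol, hI0, hd⟩ := h1 (F ε) (hF ε hε.le).1 (hF ε hε.le).2 I₀ hI₀
    refine ⟨θ, I, hα0 ▸ hsol, hI0, ?_⟩
    have hnorm := norm_le_pi_norm (I (c * ε⁻¹) - I₀) (.inl j)
    refine le_trans ?_ hnorm
    have hgj := (norm_le_pi_norm (gradPartialAverage (F ε) θstar Istar
      - gradPartialAverage f θstar Istar) j).trans h2.le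
    rw [Pi.sub_apply, ← hv, Real.norm_eq_abs] at hgj
    rw [Pi.sub_apply, Real.norm_eq_abs]
    set w := gradPartialAverage (F ε) θstar Istar j
    set Δ := I (c * ε⁻¹) (.inl j) - I₀ (.inl j)
    have hw : |v| ≤ |w| + |v| / 8 := by
      have := abs_sub_abs_le_abs_sub v w
      rw [abs_sub_comm] at this
      linarith
    have hcw : c * |w| ≤ |Δ| + c * (K * (c + c) + |v| / 8) := by
      have := abs_sub_abs_le_abs_sub (c * w) (-Δ)
      rw [abs_neg, sub_neg_eq_add, add_comm (c * w), abs_mul, abs_of_pos hc] at this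
      linarith
    -- |w| ≥ 7|v|/8 and the errors total c|v|/4, so |Δ| ≥ 5c|v|/8, which exceeds c₁.
    nlinarith
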